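/- **Proposition.** Consider square lattice walks starting at $(0,0)$ with steps $\mathsf N=(0,1)$, $\mathsf E=(1,0)$, $\mathsf S=(0,-1)$, $\mathsf W=(-1,0)$. A *quarter plane loop* is such a walk that ends at $(0,0)$ and visits only points $(x,y)$ with $x\ge 0$ and $y\ge 0$. A *corner* of a walk is a pair of consecutive steps equal to $\mathsf{NW}$ or to $\mathsf{ES}$. Let $Q(a,u)\in\mathbb Z[a][[u]]$ be the generating function of quarter plane loops counted by the number of corners (variable $a$) and the half-length (variable $u$), and let $Q(a,s,u)\in\mathbb Z[a,s][[u]]$ be its refinement in which the variable $s$ additionally records the number of $\mathsf E$ steps. Let $C_i=\frac{1}{i+1}\binom{2i}{i}$ be the $i$-th Catalan number. Then $$Q(1,u)=\sum_{i,j\ge 0}\binom{2i+2j}{2i}C_iC_j\,u^{i+j}=\sum_{n\ge 0}C_nC_{n+1}\,u^n,$$ $$Q(1,s,u)=\sum_{i,j\ge 0}\binom{2i+2j}{2i}C_iC_j\,s^i u^{i+j},$$ $$Q(-1,s,u)=\sum_{i,j\ge 0}\binom{i+j}{i}C_iC_j\,s^i u^{i+j}.$$ -/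

import Mathlib

namespace QuarterPlane

/-- The four unit steps of the square lattice. -/
inductive Step
  | N | E | S | W
  deriving DecidableEq

instance : Fintype Step where
  elems := {.N, .E, .S, .W}
  complete x := by cases x <;> decide

/-- The displacement of a step. -/
def Step.vec : Step → ℤ × ℤ
  | .N => (0, 1)
  | .E => (1, 0)
  | .S => (0, -1)
  | .W => (-1, 0)

/-- The point reached from the origin by a square lattice walk. -/
def endpoint (w : List Step) : ℤ × ℤ := (w.map Step.vec).sum

/-- A walk starting at the origin is a loop if it ends at the origin. -/
def IsLoop (w : List Step) : Prop := endpoint w = (0, 0)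

/-- A quarter plane walk: every point visited has non-negative coordinates. -/
def InQuarterPlane (w : List Step) : Prop :=
  ∀ k ≤ w.length, 0 ≤ (endpoint (w.take k)).1 ∧ 0 ≤ (endpoint (w.take k)).2

instance (w : List Step) : Decidable (IsLoop w) := by
  unfold IsLoop; infer_instance

instance (w : List Step) : Decidable (InQuarterPlane w) := by
  unfold InQuarterPlane; infer_instance

/-- The number of corners of a walk, that is, the number of pairs of consecutive steps
that are equal to `NW` or to `ES`. -/
def corners (w : List Step) : ℕ :=
  (w.zip w.tail).count (Step.N, Step.W) + (w.zip w.tail).count (Step.E, Step.S)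

/-- The finite set of quarter plane loops of half-length `n`. -/
def loops (n : ℕ) : Finset (List.Vector Step (2 * n)) :=
  Finset.univ.filter fun w => IsLoop w.toList ∧ InQuarterPlane w.toList

/-- The series `Q(a,u)` in `ℤ[a][[u]]`: quarter plane loops counted by corners (`a`) and
half-length (`u`). -/
noncomputable def Q : PowerSeries (Polynomial ℤ) :=
  PowerSeries.mk fun n => ∑ w ∈ loops n, Polynomial.X ^ corners w.toList

/-- The series `Q(a,s,u)` in `ℤ[a][s][[u]]`: quarter plane loops counted by corners (`a`),
`E` steps (`s`) and half-length (`u`). The inner polynomial variable is `a`, the outer one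
is `s`. -/
noncomputable def QRef : PowerSeries (Polynomial (Polynomial ℤ)) :=
  PowerSeries.mk fun n => ∑ w ∈ loops n,
    Polynomial.C (Polynomial.X ^ corners w.toList) * Polynomial.X ^ w.toList.count Step.E

/-- The specialization `Q(r,u)` in `ℤ[[u]]` of `Q(a,u)` at `a = r`. -/
noncomputable def QAt (r : ℤ) : PowerSeries ℤ :=
  PowerSeries.map (Polynomial.evalRingHom r) Q

/-- The specialization `Q(r,s,u)` in `ℤ[s][[u]]` of `Q(a,s,u)` at `a = r`. -/
noncomputable def QRefAt (r : ℤ) : PowerSeries (Polynomial ℤ) :=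
  PowerSeries.map (Polynomial.mapRingHom (Polynomial.evalRingHom r)) QRef

end QuarterPlane

/-! The quarter plane condition splits by coordinate: a walk is a quarter plane loop exactly when
its `E`/`W` steps and its `N`/`S` steps each form a Dyck word. Loops are thus shuffles of two Dyck
words, and a pair of semilengths `i`, `j` has `C_i C_j` choices, with `i` steps `E`. At `a = 1` one
counts shuffles, which gives the binomial coefficient; Vandermonde's identity then yields `C_n
C_{n+1}`.

At `a = -1` the signed count of shuffles satisfies a Pascal recurrence with a correction
(`signedCount_cons_cons`). It implies that the count is unchanged when the letters of either word
are permuted (`signedCount_perm_left`), so both words may be taken to be `UDUD⋯UD`, where the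
corrections cancel in blocks (`signedCount_zigzag`). -/

namespace QuarterPlane

/-! ### Projections of a walk to the two axes -/

/-- The horizontal steps, read as steps of a Dyck word. -/
def Step.horizontal : Step → Option DyckStep
  | .E => some .U
  | .W => some .D
  | _ => none

/-- The vertical steps, read as steps of a Dyck word. -/
def Step.vertical : Step → Option DyckStep
  | .N => some .U
  | .S => some .D
  | _ => none

/-- The horizontal step corresponding to a step of a Dyck word. -/
def ofHorizontal : DyckStep → Step
  | .U => .E
  | .D => .W

/-- The vertical step corresponding to a step of a Dyck word. -/
def ofVertical : DyckStep → Step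
  | .U => .N
  | .D => .S

lemma count_U_horizontal (w : List Step) :
    (w.filterMap Step.horizontal).count .U = w.count .E := by
  induction w with
  | nil => rfl
  | cons s w ih => cases s <;> simp [List.filterMap_cons, Step.horizontal, ih]

lemma count_D_horizontal (w : List Step) :
    (w.filterMap Step.horizontal).count .D = w.count .W := by
  induction w with
  | nil => rfl
  | cons s w ih => cases s <;> simp [List.filterMap_cons, Step.horizontal, ih]

lemma count_U_vertical (w : List Step) :
    (w.filterMap Step.vertical).count .U = w.count .N := by
  induction w with
  | nil => rfl
  | cons s w ih => cases s <;> simp [List.filterMap_cons, Step.vertical, ih]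

lemma count_D_vertical (w : List Step) :
    (w.filterMap Step.vertical).count .D = w.count .S := by
  induction w with
  | nil => rfl
  | cons s w ih => cases s <;> simp [List.filterMap_cons, Step.vertical, ih]

lemma length_eq_horizontal_add_vertical (w : List Step) :
    w.length = (w.filterMap Step.horizontal).length + (w.filterMap Step.vertical).length := by
  induction w with
  | nil => rfl
  | cons s w ih => cases s <;> simp [List.filterMap_cons, Step.horizontal, Step.vertical, ih] <;> omega

lemma endpoint_eq_count (w : List Step) :
    endpoint w = ((w.count .E : ℤ) - w.count .W, (w.count .N : ℤ) - w.count .S) := by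
  induction w with
  | nil => rfl
  | cons s w ih =>
    have h : endpoint (s :: w) = s.vec + endpoint w := by simp [endpoint]
    rw [h, ih]
    cases s <;> simp [Step.vec] <;> ring

/-- The conditions defining a Dyck word. -/
def IsDyck (l : List DyckStep) : Prop :=
  l.count .U = l.count .D ∧ ∀ i, (l.take i).count .D ≤ (l.take i).count .U

lemma isDyck_toList (d : DyckWord) : IsDyck d.toList :=
  ⟨d.count_U_eq_count_D, d.count_D_le_count_U⟩

/-- Indices are not preserved by projection to an axis, but prefixes are; hence the passage from
`take` to prefixes. -/
lemma forall_take_iff_forall_prefix {α : Type*} (P : List α → Prop) (l : List α) :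
    (∀ i, P (l.take i)) ↔ ∀ p, p <+: l → P p := by
  constructor
  · intro h p hp
    rw [List.prefix_iff_eq_take.1 hp]
    exact h _
  · exact fun h i => h _ (List.take_prefix i l)

lemma inQuarterPlane_iff (w : List Step) :
    InQuarterPlane w ↔ ∀ p, p <+: w → p.count .W ≤ p.count .E ∧ p.count .S ≤ p.count .N := by
  rw [← forall_take_iff_forall_prefix]
  unfold InQuarterPlane
  simp only [endpoint_eq_count, sub_nonneg, Nat.cast_le]
  refine ⟨fun h i => ?_, fun h k _ => h k⟩
  rcases le_total i w.length with hi | hi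
  · exact h i hi
  · simpa [List.take_of_length_le hi] using h w.length le_rfl

lemma forall_prefix_filterMap {α β : Type*} (f : α → Option β) (P : List β → Prop) (l : List α) :
    (∀ p, p <+: l.filterMap f → P p) ↔ ∀ p, p <+: l → P (p.filterMap f) := by
  constructor
  · exact fun h p hp => h _ (hp.filterMap f)
  · intro h p hp
    obtain ⟨q, hq, rfl⟩ := List.prefix_filterMap_iff.1 hp
    exact h q hq

/-- A walk is a quarter plane loop iff both of its projections are Dyck words. -/
lemma isLoop_and_inQuarterPlane_iff (w : List Step) :
    IsLoop w ∧ InQuarterPlane w ↔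
      IsDyck (w.filterMap Step.horizontal) ∧ IsDyck (w.filterMap Step.vertical) := by
  have hH := forall_prefix_filterMap Step.horizontal (fun p => p.count .D ≤ p.count .U) w
  have hV := forall_prefix_filterMap Step.vertical (fun p => p.count .D ≤ p.count .U) w
  simp only [count_U_horizontal, count_D_horizontal] at hH
  simp only [count_U_vertical, count_D_vertical] at hV
  unfold IsDyck
  rw [forall_take_iff_forall_prefix (fun p => p.count DyckStep.D ≤ p.count DyckStep.U),
    forall_take_iff_forall_prefix (fun p => p.count DyckStep.D ≤ p.count DyckStep.U),
    hH, hV, inQuarterPlane_iff, count_U_horizontal, count_D_horizontal, count_U_vertical,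
    count_D_vertical]
  simp only [IsLoop, endpoint_eq_count, Prod.mk.injEq, sub_eq_zero, Nat.cast_inj, forall_and]
  tauto

/-! ### Shuffles -/

/-- The walks with prescribed projections to the axes. -/
def shuffles : List DyckStep → List DyckStep → Finset (List Step)
  | [], v => {v.map ofVertical}
  | a :: u, [] => {(a :: u).map ofHorizontal}
  | a :: u, b :: v =>
    (shuffles u (b :: v)).map ⟨List.cons (ofHorizontal a), List.cons_injective⟩ ∪
      (shuffles (a :: u) v).map ⟨List.cons (ofVertical b), List.cons_injective⟩
  termination_by u v => u.length + v.length

lemma shuffles_nil_left (v : List DyckStep) : shuffles [] v = {v.map ofVertical} := by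
  rw [shuffles]

lemma shuffles_nil_right (u : List DyckStep) : shuffles u [] = {u.map ofHorizontal} := by
  cases u <;> simp [shuffles]

lemma horizontal_eq_nil_iff (w : List Step) (v : List DyckStep) :
    w = v.map ofVertical ↔
      w.filterMap Step.horizontal = [] ∧ w.filterMap Step.vertical = v := by
  induction w generalizing v with
  | nil => simp [eq_comm]
  | cons s w ih =>
    rcases v with - | ⟨b, v⟩
    · cases s <;> simp [Step.horizontal, Step.vertical]
    · cases s <;> cases b <;> simp [Step.horizontal, Step.vertical, ofVertical, ih]

lemma vertical_eq_nil_iff (w : List Step) (u : List DyckStep) :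
    w = u.map ofHorizontal ↔
      w.filterMap Step.horizontal = u ∧ w.filterMap Step.vertical = [] := by
  induction w generalizing u with
  | nil => simp [eq_comm]
  | cons s w ih =>
    rcases u with - | ⟨b, v⟩
    · cases s <;> simp [Step.horizontal, Step.vertical]
    · cases s <;> cases b <;> simp [Step.horizontal, Step.vertical, ofHorizontal, ih]

lemma mem_shuffles {w : List Step} {u v : List DyckStep} :
    w ∈ shuffles u v ↔ w.filterMap Step.horizontal = u ∧ w.filterMap Step.vertical = v := by
  induction w generalizing u v with
  | nil =>
    rcases u with - | ⟨a, u⟩ <;> rcases v with - | ⟨b, v⟩ <;> simp [shuffles]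
  | cons s w ih =>
    rcases u with - | ⟨a, u⟩
    · rw [shuffles_nil_left, Finset.mem_singleton, horizontal_eq_nil_iff]
    · rcases v with - | ⟨b, v⟩
      · rw [shuffles_nil_right, Finset.mem_singleton, vertical_eq_nil_iff]
      · rw [shuffles]
        cases s <;> cases a <;> cases b <;>
          simp +contextual [List.filterMap_cons, Step.horizontal, Step.vertical, ofHorizontal,
            ofVertical, ih]

lemma sum_shuffles_cons_cons {M : Type*} [AddCommMonoid M] (f : List Step → M) (a b : DyckStep)
    (u v : List DyckStep) :
    ∑ w ∈ shuffles (a :: u) (b :: v), f w =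
      ∑ w ∈ shuffles u (b :: v), f (ofHorizontal a :: w) +
        ∑ w ∈ shuffles (a :: u) v, f (ofVertical b :: w) := by
  rw [shuffles, Finset.sum_union, Finset.sum_map, Finset.sum_map]
  · rfl
  · rw [Finset.disjoint_left]
    intro w hw hw'
    simp only [Finset.mem_map, Function.Embedding.coeFn_mk] at hw hw'
    obtain ⟨x, -, rfl⟩ := hw
    obtain ⟨y, -, hy⟩ := hw'
    cases a <;> cases b <;> simp [ofHorizontal, ofVertical] at hy

lemma card_shuffles (u v : List DyckStep) :
    (shuffles u v).card = (u.length + v.length).choose u.length := by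
  induction u generalizing v with
  | nil => simp [shuffles]
  | cons a u ihu =>
    induction v with
    | nil => simp [shuffles]
    | cons b v ihv =>
      have h := sum_shuffles_cons_cons (fun _ => 1) a b u v
      simp only [Finset.sum_const, smul_eq_mul, mul_one, ihu, ihv] at h
      rw [h]
      simp only [List.length_cons]
      rw [show u.length + 1 + (v.length + 1) = (u.length + (v.length + 1)) + 1 by ring,
        Nat.choose_succ_succ, show u.length + 1 + v.length = u.length + (v.length + 1) by ring]

/-! ### Signed count of shuffles -/

lemma corners_cons_cons (s t : Step) (w : List Step) :
    corners (s :: t :: w) =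
      corners (t :: w) + if (s = .N ∧ t = .W) ∨ (s = .E ∧ t = .S) then 1 else 0 := by
  cases s <;> cases t <;> simp [corners] <;> ring

/-- The sign of a walk. -/
def sign (w : List Step) : ℤ := (-1) ^ corners w

lemma sign_cons_cons (s t : Step) (w : List Step) :
    sign (s :: t :: w) =
      (if (s = .N ∧ t = .W) ∨ (s = .E ∧ t = .S) then -1 else 1) * sign (t :: w) := by
  rw [sign, corners_cons_cons, pow_add, sign, mul_comm]
  split_ifs <;> simp

lemma sign_cons_of_forall {s : Step} (h₁ : s ≠ .N) (h₂ : s ≠ .E) (w : List Step) :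
    sign (s :: w) = sign w := by
  cases w with
  | nil => simp [sign, corners]
  | cons t w => rw [sign_cons_cons]; simp [h₁, h₂]

lemma sign_map_ofVertical (v : List DyckStep) : sign (v.map ofVertical) = 1 := by
  induction v with
  | nil => simp [sign, corners]
  | cons a v ih =>
    cases v with
    | nil => simp [sign, corners]
    | cons b v =>
      rw [List.map_cons, List.map_cons, sign_cons_cons, ← List.map_cons, ih]
      cases a <;> cases b <;> simp [ofVertical]

lemma sign_map_ofHorizontal (v : List DyckStep) : sign (v.map ofHorizontal) = 1 := by
  induction v with
  | nil => simp [sign, corners]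
  | cons a v ih =>
    cases v with
    | nil => simp [sign, corners]
    | cons b v =>
      rw [List.map_cons, List.map_cons, sign_cons_cons, ← List.map_cons, ih]
      cases a <;> cases b <;> simp [ofHorizontal]

/-- The number of walks with given projections to the axes, counted with sign. -/
def signedCount (u v : List DyckStep) : ℤ := ∑ w ∈ shuffles u v, sign w

lemma signedCount_nil_left (v : List DyckStep) : signedCount [] v = 1 := by
  simp [signedCount, shuffles_nil_left, sign_map_ofVertical]

lemma signedCount_nil_right (u : List DyckStep) : signedCount u [] = 1 := by
  simp [signedCount, shuffles_nil_right, sign_map_ofHorizontal]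

/-- Prepending a horizontal step changes the sign only if it is `E`, and the walk starts with
`S`. -/
lemma sum_sign_cons_ofHorizontal (a b : DyckStep) (u v : List DyckStep) :
    ∑ w ∈ shuffles u (b :: v), sign (ofHorizontal a :: w) =
      signedCount u (b :: v) - if a = .U ∧ b = .D then 2 * signedCount u v else 0 := by
  cases u with
  | nil =>
    simp only [shuffles_nil_left, Finset.sum_singleton, signedCount_nil_left, List.map_cons,
      sign_cons_cons]
    rw [← List.map_cons, sign_map_ofVertical]
    cases a <;> cases b <;> simp [ofHorizontal, ofVertical]
  | cons c u =>
    rw [signedCount, sum_shuffles_cons_cons, sum_shuffles_cons_cons]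
    simp only [sign_cons_cons (ofHorizontal a)]
    rw [← Finset.mul_sum, ← Finset.mul_sum]
    cases b with
    | U => cases a <;> cases c <;> simp [ofHorizontal, ofVertical]
    | D =>
      -- No corner starts with `S`, so the terms whose sign may flip sum to `signedCount (c :: u)
      -- v`; flipping them subtracts twice this.
      have h : ∑ w ∈ shuffles (c :: u) v, sign (ofVertical .D :: w) = signedCount (c :: u) v :=
        Finset.sum_congr rfl fun w _ => sign_cons_of_forall (by simp [ofVertical])
          (by simp [ofVertical]) w
      rw [h]
      cases a <;> cases c <;> simp [ofHorizontal, ofVertical] <;> ring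

/-- Prepending a vertical step changes the sign only if it is `N`, and the walk starts with
`W`. -/
lemma sum_sign_cons_ofVertical (a b : DyckStep) (u v : List DyckStep) :
    ∑ w ∈ shuffles (a :: u) v, sign (ofVertical b :: w) =
      signedCount (a :: u) v - if b = .U ∧ a = .D then 2 * signedCount u v else 0 := by
  cases v with
  | nil =>
    simp only [shuffles_nil_right, Finset.sum_singleton, signedCount_nil_right, List.map_cons,
      sign_cons_cons]
    rw [← List.map_cons, sign_map_ofHorizontal]
    cases a <;> cases b <;> simp [ofHorizontal, ofVertical]
  | cons c v =>
    rw [signedCount, sum_shuffles_cons_cons, sum_shuffles_cons_cons]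
    simp only [sign_cons_cons (ofVertical b)]
    rw [← Finset.mul_sum, ← Finset.mul_sum]
    cases a with
    | U => cases b <;> cases c <;> simp [ofHorizontal, ofVertical]
    | D =>
      have h : ∑ w ∈ shuffles u (c :: v), sign (ofHorizontal .D :: w) = signedCount u (c :: v) :=
        Finset.sum_congr rfl fun w _ => sign_cons_of_forall (by simp [ofHorizontal])
          (by simp [ofHorizontal]) w
      rw [h]
      cases b <;> cases c <;> simp [ofHorizontal, ofVertical] <;> ring

/-- The two leading letters can form a corner only if they differ: `U`, `D` give `ES` and `D`, `U`
give `NW`. In either case only one of the two orders is a corner. -/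
lemma signedCount_cons_cons (a b : DyckStep) (u v : List DyckStep) :
    signedCount (a :: u) (b :: v) =
      signedCount u (b :: v) + signedCount (a :: u) v -
        if a = b then 0 else 2 * signedCount u v := by
  rw [signedCount, sum_shuffles_cons_cons, sum_sign_cons_ofHorizontal, sum_sign_cons_ofVertical]
  cases a <;> cases b <;> simp <;> ring

lemma signedCount_comm (u v : List DyckStep) : signedCount u v = signedCount v u := by
  induction u generalizing v with
  | nil => rw [signedCount_nil_left, signedCount_nil_right]
  | cons a u ihu =>
    induction v with
    | nil => rw [signedCount_nil_left, signedCount_nil_right]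
    | cons b v ihv =>
      rw [signedCount_cons_cons, signedCount_cons_cons, ihu, ihu, ihv]
      simp only [eq_comm (a := a), add_comm]

/-- Exactly one of `U`, `D` differs from the head `b` of `v`, so the correction `-2 * signedCount u
v` occurs once and cancels the induction hypothesis. -/
lemma signedCount_U_add_D (u v : List DyckStep) :
    signedCount (.U :: u) v + signedCount (.D :: u) v = 2 * signedCount u v := by
  induction v with
  | nil => simp [signedCount_nil_right]
  | cons b v ih => cases b <;> simp [signedCount_cons_cons] <;> linarith

/-- Expanding both sides by the recurrence, their difference reduces to the induction hypothesis and
`signedCount_U_add_D`. -/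
lemma signedCount_swap (u v : List DyckStep) :
    signedCount (.U :: .D :: u) v = signedCount (.D :: .U :: u) v := by
  induction v with
  | nil => simp [signedCount_nil_right]
  | cons b v ih =>
    have h := signedCount_U_add_D u v
    cases b <;> simp [signedCount_cons_cons] <;> linarith

lemma signedCount_perm_left {u u' : List DyckStep} (h : u.Perm u') (v : List DyckStep) :
    signedCount u v = signedCount u' v := by
  induction h generalizing v with
  | nil => rfl
  | cons a _ ih =>
    induction v with
    | nil => simp only [signedCount_nil_right]
    | cons b v ihv => rw [signedCount_cons_cons, signedCount_cons_cons, ih, ih, ihv]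
  | swap a b u => cases a <;> cases b <;> simp [signedCount_swap]
  | trans _ _ ih₁ ih₂ => rw [ih₁, ih₂]

/-- The Dyck word `UDUD⋯UD`. -/
def zigzag : ℕ → List DyckStep
  | 0 => []
  | n + 1 => .U :: .D :: zigzag n

lemma count_zigzag (n : ℕ) (a : DyckStep) : (zigzag n).count a = n := by
  induction n with
  | zero => rfl
  | succ n ih => cases a <;> simp [zigzag, ih]

lemma signedCount_zigzag (i j : ℕ) :
    signedCount (zigzag i) (zigzag j) = (i + j).choose i := by
  induction i generalizing j with
  | zero => simp [zigzag, signedCount_nil_left]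
  | succ i ihi =>
    induction j with
    | zero => simp [zigzag, signedCount_nil_right]
    | succ j ihj =>
      -- Expanding two letters deep, the four correction terms cancel against the two copies of the
      -- count for both words with their first `U` removed.
      have h : signedCount (zigzag (i + 1)) (zigzag (j + 1)) =
          signedCount (zigzag i) (zigzag (j + 1)) + signedCount (zigzag (i + 1)) (zigzag j) := by
        simp only [zigzag, signedCount_cons_cons]
        simp
        ring
      rw [h, ihi, ihj, show i + 1 + (j + 1) = (i + (j + 1)) + 1 by ring, Nat.choose_succ_succ,
        show i + 1 + j = i + (j + 1) by ring]
      push_cast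
      ring

lemma perm_zigzag (d : DyckWord) : d.toList.Perm (zigzag d.semilength) := by
  rw [List.perm_iff_count]
  intro a
  rw [count_zigzag]
  cases a
  · rfl
  · exact d.semilength_eq_count_D.symm

lemma signedCount_dyckWord (d e : DyckWord) :
    signedCount d.toList e.toList = (d.semilength + e.semilength).choose d.semilength := by
  rw [signedCount_perm_left (perm_zigzag d), signedCount_comm,
    signedCount_perm_left (perm_zigzag e), signedCount_comm, signedCount_zigzag]

/-! ### Decomposition of loops -/

/-- The Dyck words of semilength `n`. -/
def dyckWords (n : ℕ) : Finset DyckWord :=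
  (Finset.univ : Finset {d : DyckWord // d.semilength = n}).map (Function.Embedding.subtype _)

lemma mem_dyckWords {d : DyckWord} {n : ℕ} : d ∈ dyckWords n ↔ d.semilength = n := by
  simp [dyckWords]

lemma card_dyckWords (n : ℕ) : (dyckWords n).card = catalan n := by
  rw [dyckWords, Finset.card_map, Finset.card_univ,
    DyckWord.card_dyckWord_semilength_eq_catalan]

lemma exists_mem_shuffles_iff (n : ℕ) (w : List Step) :
    (w.length = 2 * n ∧ IsLoop w ∧ InQuarterPlane w) ↔
      ∃ p ∈ Finset.HasAntidiagonal.antidiagonal n, ∃ q ∈ dyckWords p.1 ×ˢ dyckWords p.2,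
        w ∈ shuffles q.1.toList q.2.toList := by
  simp only [isLoop_and_inQuarterPlane_iff, Finset.mem_product, mem_dyckWords, mem_shuffles,
    Finset.HasAntidiagonal.mem_antidiagonal]
  constructor
  · rintro ⟨hlen, hH, hV⟩
    let d : DyckWord := ⟨_, hH.1, hH.2⟩
    let e : DyckWord := ⟨_, hV.1, hV.2⟩
    refine ⟨(d.semilength, e.semilength), ?_, (d, e), ⟨rfl, rfl⟩, rfl, rfl⟩
    rw [length_eq_horizontal_add_vertical] at hlen
    have h₁ : 2 * d.semilength = _ := d.two_mul_semilength_eq_length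
    have h₂ : 2 * e.semilength = _ := e.two_mul_semilength_eq_length
    simp only [d, e] at h₁ h₂ ⊢
    omega
  · rintro ⟨⟨i, j⟩, hij, ⟨d, e⟩, ⟨hd, he⟩, hH, hV⟩
    dsimp only at hd he hH hV hij
    rw [length_eq_horizontal_add_vertical, hH, hV]
    refine ⟨?_, isDyck_toList d, isDyck_toList e⟩
    rw [← d.two_mul_semilength_eq_length, ← e.two_mul_semilength_eq_length]
    omega

lemma map_loops (n : ℕ) :
    (loops n).map ⟨List.Vector.toList, List.Vector.toList_injective⟩ =
      ((Finset.HasAntidiagonal.antidiagonal n).biUnion fun p =>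
        dyckWords p.1 ×ˢ dyckWords p.2).biUnion fun q => shuffles q.1.toList q.2.toList := by
  ext w
  rw [Finset.biUnion_biUnion]
  simp only [Finset.mem_biUnion]
  rw [← exists_mem_shuffles_iff]
  simp only [Finset.mem_map, loops, Finset.mem_filter, Finset.mem_univ, true_and,
    Function.Embedding.coeFn_mk]
  constructor
  · rintro ⟨x, hx, rfl⟩
    exact ⟨x.toList_length, hx⟩
  · rintro ⟨hl, hw⟩
    exact ⟨⟨w, hl⟩, hw, rfl⟩

lemma sum_loops {M : Type*} [AddCommMonoid M] (f : List Step → M) (n : ℕ) :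
    ∑ w ∈ loops n, f w.toList =
      ∑ p ∈ Finset.HasAntidiagonal.antidiagonal n, ∑ q ∈ dyckWords p.1 ×ˢ dyckWords p.2,
        ∑ w ∈ shuffles q.1.toList q.2.toList, f w := by
  have h := Finset.sum_map (loops n) ⟨List.Vector.toList, List.Vector.toList_injective⟩ f
  rw [map_loops, Finset.sum_biUnion, Finset.sum_biUnion] at h
  · exact h.symm
  -- Disjointness: a pair of Dyck words determines its semilengths, and below, a walk determines its
  -- projections.
  · rintro p - p' - hne
    rw [Function.onFun, Finset.disjoint_left]
    intro q hq hq'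
    simp only [Finset.mem_product, mem_dyckWords] at hq hq'
    exact hne (Prod.ext (hq.1.symm.trans hq'.1) (hq.2.symm.trans hq'.2))
  · rintro q - q' - hne
    rw [Function.onFun, Finset.disjoint_left]
    intro w hw hw'
    rw [mem_shuffles] at hw hw'
    exact hne (Prod.ext (DyckWord.ext (hw.1.symm.trans hw'.1))
      (DyckWord.ext (hw.2.symm.trans hw'.2)))

lemma count_E_of_mem_shuffles {w : List Step} {d : DyckWord} {v : List DyckStep}
    (h : w ∈ shuffles d.toList v) : w.count .E = d.semilength := by
  rw [← count_U_horizontal, (mem_shuffles.1 h).1, DyckWord.semilength]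

/-- If the weighted number of shuffles of two Dyck words depends only on their semilengths, then
the sum over loops factors. -/
lemma sum_loops_eq_of_sum_shuffles {R : Type*} [CommSemiring R] (f : List Step → R)
    (c g : ℕ → ℕ → R)
    (h : ∀ d e : DyckWord, ∑ w ∈ shuffles d.toList e.toList, f w =
      c d.semilength e.semilength * g d.semilength e.semilength) (n : ℕ) :
    ∑ w ∈ loops n, f w.toList =
      ∑ p ∈ Finset.HasAntidiagonal.antidiagonal n,
        c p.1 p.2 * (catalan p.1 : R) * (catalan p.2 : R) * g p.1 p.2 := by
  rw [sum_loops]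
  refine Finset.sum_congr rfl fun p _ => ?_
  have h' : ∀ q ∈ dyckWords p.1 ×ˢ dyckWords p.2,
      ∑ w ∈ shuffles q.1.toList q.2.toList, f w = c p.1 p.2 * g p.1 p.2 := by
    intro q hq
    rw [Finset.mem_product, mem_dyckWords, mem_dyckWords] at hq
    rw [h, hq.1, hq.2]
  rw [Finset.sum_congr rfl h', Finset.sum_const, Finset.card_product, card_dyckWords,
    card_dyckWords, nsmul_eq_mul]
  push_cast
  ring

lemma coeff_QAt (r : ℤ) (n : ℕ) :
    PowerSeries.coeff n (QAt r) = ∑ w ∈ loops n, r ^ corners w.toList := by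
  simp [QAt, Q]

lemma coeff_QRefAt (r : ℤ) (n : ℕ) :
    PowerSeries.coeff n (QRefAt r) =
      ∑ w ∈ loops n,
        Polynomial.C (r ^ corners w.toList) * Polynomial.X ^ w.toList.count Step.E := by
  simp [QRefAt, QRef]

lemma card_shuffles_dyckWord (d e : DyckWord) :
    (shuffles d.toList e.toList).card =
      (2 * d.semilength + 2 * e.semilength).choose (2 * d.semilength) := by
  rw [card_shuffles, ← d.two_mul_semilength_eq_length, ← e.two_mul_semilength_eq_length]

/-! ### The Catalan number identity -/

lemma catalan_mul_factorial (n : ℕ) :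
    catalan n * (n.factorial * (n + 1).factorial) = (2 * n).factorial := by
  have h := succ_mul_catalan_eq_centralBinom n
  have h' := Nat.choose_mul_factorial_mul_factorial (show n ≤ 2 * n by omega)
  rw [← Nat.centralBinom_eq_two_mul_choose, ← h, show 2 * n - n = n by omega] at h'
  rw [← h', Nat.factorial_succ]
  ring

/-- With `n = i + j`, both sides equal `(2n)! (n+1)!² / (i! (i+1)! j! (j+1)!)`. The factor `(n+1)!²`
produces a Vandermonde summand. -/
lemma choose_mul_catalan_mul_catalan (i j : ℕ) :
    (2 * i + 2 * j).choose (2 * i) * catalan i * catalan j *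
        ((i + j + 1).factorial * (i + j + 1).factorial) =
      (2 * (i + j)).factorial * ((i + j + 1).choose i * (i + j + 1).choose j) := by
  have hi := catalan_mul_factorial i
  have hj := catalan_mul_factorial j
  have h := Nat.add_choose_mul_factorial_mul_factorial (2 * i) (2 * j)
  rw [← Nat.choose_symm_add] at h
  have h₁ := Nat.add_choose_mul_factorial_mul_factorial i (j + 1)
  have h₂ := Nat.add_choose_mul_factorial_mul_factorial j (i + 1)
  rw [← Nat.choose_symm_add, ← add_assoc] at h₁
  rw [← Nat.choose_symm_add, show j + (i + 1) = i + j + 1 by ring] at h₂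
  rw [← mul_add] at h ⊢
  have hpos : 0 < (i.factorial * (i + 1).factorial) * (j.factorial * (j + 1).factorial) := by
    positivity
  refine Nat.eq_of_mul_eq_mul_right hpos ?_
  calc _ = (2 * (i + j)).choose (2 * i) * (catalan i * (i.factorial * (i + 1).factorial)) *
        (catalan j * (j.factorial * (j + 1).factorial)) *
        ((i + j + 1).factorial * (i + j + 1).factorial) := by ring
    _ = (2 * (i + j)).factorial * ((i + j + 1).factorial * (i + j + 1).factorial) := by
        rw [hi, hj, h]
    _ = (2 * (i + j)).factorial *
        (((i + j + 1).choose i * i.factorial * (j + 1).factorial) *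
          ((i + j + 1).choose j * j.factorial * (i + 1).factorial)) := by rw [h₁, h₂]
    _ = _ := by ring

lemma sum_choose_mul_catalan_mul_catalan (n : ℕ) :
    ∑ p ∈ Finset.HasAntidiagonal.antidiagonal n,
      (2 * p.1 + 2 * p.2).choose (2 * p.1) * catalan p.1 * catalan p.2 =
        catalan n * catalan (n + 1) := by
  have hpos : 0 < (n + 1).factorial * (n + 1).factorial := by positivity
  refine Nat.eq_of_mul_eq_mul_right hpos ?_
  rw [Finset.sum_mul]
  have h : ∀ p ∈ Finset.HasAntidiagonal.antidiagonal n,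
      (2 * p.1 + 2 * p.2).choose (2 * p.1) * catalan p.1 * catalan p.2 *
        ((n + 1).factorial * (n + 1).factorial) =
      (2 * n).factorial * ((n + 1).choose p.1 * (n + 1).choose p.2) := by
    rintro ⟨i, j⟩ hp
    obtain rfl := Finset.HasAntidiagonal.mem_antidiagonal.1 hp
    exact choose_mul_catalan_mul_catalan i j
  -- Vandermonde: the sum becomes the binomial coefficient of `2(n+1)` over `n`, whose denominator
  -- `n! (n+2)!` is cleared next.
  rw [Finset.sum_congr rfl h, ← Finset.mul_sum, ← Nat.add_choose_eq]
  have h₀ := catalan_mul_factorial n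
  have h₁ := catalan_mul_factorial (n + 1)
  have h₂ := Nat.choose_mul_factorial_mul_factorial (show n ≤ 2 * (n + 1) by omega)
  rw [show 2 * (n + 1) - n = n + 2 by omega] at h₂
  have hpos' : 0 < n.factorial * (n + 2).factorial := by positivity
  refine Nat.eq_of_mul_eq_mul_right hpos' ?_
  rw [← two_mul]
  calc _ = (2 * n).factorial * ((2 * (n + 1)).choose n * n.factorial * (n + 2).factorial) := by
        ring
    _ = (catalan n * (n.factorial * (n + 1).factorial)) *
        (catalan (n + 1) * ((n + 1).factorial * (n + 1 + 1).factorial)) := by rw [h₂, h₀, h₁]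
    _ = _ := by ring

/-! ### Coefficients of the specialized series -/

lemma coeff_QAt_one (n : ℕ) :
    PowerSeries.coeff n (QAt 1) =
      ((∑ p ∈ Finset.HasAntidiagonal.antidiagonal n,
        (2 * p.1 + 2 * p.2).choose (2 * p.1) * catalan p.1 * catalan p.2 : ℕ) : ℤ) := by
  rw [coeff_QAt, sum_loops_eq_of_sum_shuffles (fun w => (1 : ℤ) ^ corners w)
    (fun i j => ((2 * i + 2 * j).choose (2 * i) : ℤ)) (fun _ _ => 1)]
  · push_cast
    simp
  · intro d e
    simp [card_shuffles_dyckWord]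

lemma coeff_QRefAt_one (n : ℕ) :
    PowerSeries.coeff n (QRefAt 1) =
      ∑ p ∈ Finset.HasAntidiagonal.antidiagonal n,
        (((2 * p.1 + 2 * p.2).choose (2 * p.1) * catalan p.1 * catalan p.2 : ℕ) :
          Polynomial ℤ) * Polynomial.X ^ p.1 := by
  rw [coeff_QRefAt, sum_loops_eq_of_sum_shuffles
    (fun w => Polynomial.C ((1 : ℤ) ^ corners w) * Polynomial.X ^ w.count Step.E)
    (fun i j => ((2 * i + 2 * j).choose (2 * i) : Polynomial ℤ)) (fun i _ => Polynomial.X ^ i)]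
  · push_cast
    rfl
  · intro d e
    -- All shuffles of `d` and `e` have the same number of `E` steps, so the power of `s` factors
    -- out.
    rw [Finset.sum_congr rfl fun w hw => by rw [count_E_of_mem_shuffles hw], ← Finset.sum_mul]
    simp [card_shuffles_dyckWord]

lemma coeff_QRefAt_neg_one (n : ℕ) :
    PowerSeries.coeff n (QRefAt (-1)) =
      ∑ p ∈ Finset.HasAntidiagonal.antidiagonal n,
        (((p.1 + p.2).choose p.1 * catalan p.1 * catalan p.2 : ℕ) :
          Polynomial ℤ) * Polynomial.X ^ p.1 := by
  rw [coeff_QRefAt, sum_loops_eq_of_sum_shuffles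
    (fun w => Polynomial.C ((-1 : ℤ) ^ corners w) * Polynomial.X ^ w.count Step.E)
    (fun i j => ((i + j).choose i : Polynomial ℤ)) (fun i _ => Polynomial.X ^ i)]
  · push_cast
    rfl
  · intro d e
    rw [Finset.sum_congr rfl fun w hw => by rw [count_E_of_mem_shuffles hw], ← Finset.sum_mul,
      ← map_sum]
    have h := signedCount_dyckWord d e
    simp only [signedCount, sign] at h
    rw [h]
    simp

end QuarterPlane

theorem mainTheorem6 :
    QuarterPlane.QAt 1 =
      PowerSeries.mk (fun n => ∑ p ∈ Finset.HasAntidiagonal.antidiagonal n,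
        (((2 * p.1 + 2 * p.2).choose (2 * p.1) * catalan p.1 * catalan p.2 : ℕ) : ℤ)) ∧
    QuarterPlane.QAt 1 =
      PowerSeries.mk (fun n => ((catalan n * catalan (n + 1) : ℕ) : ℤ)) ∧
    QuarterPlane.QRefAt 1 =
      PowerSeries.mk (fun n => ∑ p ∈ Finset.HasAntidiagonal.antidiagonal n,
        (((2 * p.1 + 2 * p.2).choose (2 * p.1) * catalan p.1 * catalan p.2 : ℕ) :
          Polynomial ℤ) * Polynomial.X ^ p.1) ∧
    QuarterPlane.QRefAt (-1) =
      PowerSeries.mk (fun n => ∑ p ∈ Finset.HasAntidiagonal.antidiagonal n,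
        (((p.1 + p.2).choose p.1 * catalan p.1 * catalan p.2 : ℕ) :
          Polynomial ℤ) * Polynomial.X ^ p.1) := by
  refine ⟨?_, ?_, ?_, ?_⟩ <;> ext1 n
  · rw [QuarterPlane.coeff_QAt_one, PowerSeries.coeff_mk, Nat.cast_sum]
  · rw [QuarterPlane.coeff_QAt_one, PowerSeries.coeff_mk,
      QuarterPlane.sum_choose_mul_catalan_mul_catalan]
  · rw [QuarterPlane.coeff_QRefAt_one, PowerSeries.coeff_mk]
  · rw [QuarterPlane.coeff_QRefAt_neg_one, PowerSeries.coeff_mk]
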